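/- The term $a_n$ of an integer sequence $A=(a_n)_{n\ge 1}$ is said to have a primitive prime divisor if there is a prime $p$ with $p\mid a_n$ and $p\nmid a_m$ for every $1\le m<n$ with $a_m\ne 0$. The Zsigmondy bound of $A$ is $$Z(A)=\max\{n\ge 1: a_n \text{ does not have a primitive prime divisor}\}$$ if this set is finite (with $Z(A)=0$ if it is empty), and $Z(A)=\infty$ otherwise. For a real quadratic field $K$ with ring of integers $R$ and a unit $\alpha\in R\setminus\{\pm1\}$, let $\Delta=(\Delta_n)_{n\ge1}$ be the integer sequence $\Delta_n=N_{K/\mathbb{Q}}(\alpha^n-1)$. **Corollary 1.3.** 1. There exists a positive integer $C_1$ such that for every real quadratic field $K$ and every unit $\alpha\in R\setminus\{\pm1\}$ with $N_{K/\mathbb{Q}}(\alpha)=1$, we have $Z(\Delta)\le C_1$. 2. There exists a positive integer $C_2$ such that for every real quadratic field $K$ and every unit $\alpha\in R\setminus\{\pm1\}$ with $N_{K/\mathbb{Q}}(\alpha)=-1$, the term $\Delta_n$ has a primitive prime divisor for every $n>C_2$ with $n\not\equiv 2\pmod 4$. -/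

import Mathlib

open scoped NumberField

/-- The term `a n` of an integer sequence `(a n)_{n ≥ 1}` has a primitive prime divisor: some prime
divides `a n` and divides no nonzero term `a m` with `1 ≤ m < n`.
Sequences are functions on `ℕ` of which only the values at `n ≥ 1` are used. -/
def HasPrimitivePrimeDivisor (a : ℕ → ℤ) (n : ℕ) : Prop :=
  ∃ p : ℕ, p.Prime ∧ (p : ℤ) ∣ a n ∧
    ∀ m : ℕ, 1 ≤ m → m < n → a m ≠ 0 → ¬ (p : ℤ) ∣ a m

/-- The indices `n ≥ 1` whose term has no primitive prime divisor. -/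
def nonPrimitiveIndices (a : ℕ → ℤ) : Set ℕ :=
  {n : ℕ | 1 ≤ n ∧ ¬ HasPrimitivePrimeDivisor a n}

open Classical in
/-- The Zsigmondy bound `Z(a)`: the largest `n ≥ 1` such that `a n` has no primitive prime divisor
if there are finitely many such `n` (and `0` if there are none), and `∞` otherwise. -/
noncomputable def zsigmondyBound (a : ℕ → ℤ) : ℕ∞ :=
  if h : (nonPrimitiveIndices a).Finite then ((h.toFinset.sup id : ℕ) : ℕ∞) else ⊤

/-- A real quadratic field: a quadratic extension of `ℚ` that embeds in `ℝ`. -/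
def IsRealQuadraticField (K : Type*) [Field K] [NumberField K] : Prop :=
  Module.finrank ℚ K = 2 ∧ Nonempty (K →+* ℝ)

/-- The Lehmer–Pierce sequence `Δ n = N (α ^ n - 1)` of an algebraic integer `α` of `K`, where `N` is
the norm from `K` to `ℚ`, which is integer-valued on the ring of integers. -/
noncomputable def lehmerPierce {K : Type*} [Field K] [NumberField K] (α : 𝓞 K) (n : ℕ) : ℤ :=
  Algebra.norm ℤ (α ^ n - 1)

/-- `lehmerPierce` is indeed given by the field norm of `K / ℚ`. -/
theorem lehmerPierce_cast {K : Type*} [Field K] [NumberField K] (α : 𝓞 K) (n : ℕ) :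
    (lehmerPierce α n : ℚ) = Algebra.norm ℚ ((α : K) ^ n - 1) := by
  simp [lehmerPierce, Algebra.coe_norm_int]

/-! Put `F = N(Φ_n(α))`, a divisor of `Δ_n`. If `Δ_n` has no primitive prime divisor, every prime `p
∣ F` divides an earlier term; two estimates of `F` then conflict for large `n`.

Arithmetic: modulo a prime `P` above `p`, `α` has order `r` with `n = p^j * r` and `p ∤ r`. The
earlier term forces `r ∣ m < n`, so `p ∣ n`. Also `Φ_n(α)` divides `Φ_p(β)` with `β = α^(n/p)`, and
`Φ_p(β)` is `p` times an element outside the relevant primes, so `p^3 ∤ F` (`p = 2` is computed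
directly). Hence `F ∣ n^2`.

Size: `|F|` is a product over primitive `n`-th roots `ζ` of `|ζ^2 - sζ + N α|`, with `s` the trace
of `α`. Comparing factors with `|±1 - ζ|` and using `|Φ_n(±1)| ≥ 1` gives `F^2 ≥ 2^φ(n)`, uniformly
in `α`. As `2^φ(n) > n^4` for `n > 8192`, this is a contradiction. -/

open Polynomial

/-! ### Primes dividing `N(Φ_n(α))`, using only the identity `N x = x * τ x`. -/

section QuadraticNorm

variable {R : Type*} [CommRing R] {τ : R →+* R} {N : R →* ℤ}

theorem intCast_mem_iff_dvd_of_natCast_mem {P : Ideal R} (hP : P.IsPrime) {p : ℕ} (hp : p.Prime)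
    (hpP : (p : R) ∈ P) (z : ℤ) : (z : R) ∈ P ↔ (p : ℤ) ∣ z := by
  constructor
  · intro hz
    by_contra hdvd
    obtain ⟨a, b, hab⟩ := ((Nat.prime_iff_prime_int.mp hp).coprime_iff_not_dvd).mpr hdvd
    apply hP.one_notMem
    have h : (a : R) * (p : R) + (b : R) * (z : R) = 1 := by
      exact_mod_cast congrArg (Int.cast : ℤ → R) hab
    rw [← h]
    exact P.add_mem (P.mul_mem_left _ hpP) (P.mul_mem_left _ hz)
  · rintro ⟨c, rfl⟩
    push_cast
    exact P.mul_mem_right _ hpP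

theorem charP_quotient_of_natCast_mem {P : Ideal R} (hP : P.IsPrime) {p : ℕ} (hp : p.Prime)
    (hpP : (p : R) ∈ P) : CharP (R ⧸ P) p := by
  refine ⟨fun x => ?_⟩
  rw [← map_natCast (Ideal.Quotient.mk P), Ideal.Quotient.eq_zero_iff_mem]
  have := intCast_mem_iff_dvd_of_natCast_mem hP hp hpP x
  rw [Int.natCast_dvd_natCast] at this
  exact_mod_cast this

theorem dvd_norm_of_mem (hN : ∀ x, (N x : R) = x * τ x) {P : Ideal R} (hP : P.IsPrime) {p : ℕ}
    (hp : p.Prime) (hpP : (p : R) ∈ P) {x : R} (hx : x ∈ P) : (p : ℤ) ∣ N x := by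
  rw [← intCast_mem_iff_dvd_of_natCast_mem hP hp hpP, hN]
  exact P.mul_mem_right _ hx

theorem map_natCast_of_eq_mul [CharZero R] (hN : ∀ x, (N x : R) = x * τ x) (m : ℕ) : N (m : R) = (m : ℤ) ^ 2 := by
  have h := hN m
  rw [map_natCast τ, ← sq] at h
  exact_mod_cast h

theorem exists_isPrime_mem_of_dvd_norm [CharZero R] (hN : ∀ x, (N x : R) = x * τ x) {p : ℕ} (hp : p.Prime)
    {x : R} (h : (p : ℤ) ∣ N x) : ∃ P : Ideal R, P.IsPrime ∧ (p : R) ∈ P ∧ x ∈ P := by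
  have hu : ¬ IsUnit (p : R) := by
    intro hu
    have h1 := hu.map N
    rw [map_natCast_of_eq_mul hN, isUnit_pow_iff two_ne_zero] at h1
    exact (Nat.prime_iff_prime_int.mp hp).not_isUnit h1
  obtain ⟨P, hP, hpP⟩ := exists_max_ideal_of_mem_nonunits hu
  have hP' := hP.isPrime
  have hx := (intCast_mem_iff_dvd_of_natCast_mem hP' hp hpP _).mpr h
  rw [hN] at hx
  rcases hP'.mem_or_mem hx with hx | hx
  · exact ⟨P, hP', hpP, hx⟩
  -- If the conjugate of `x` lies in `P`, then `x` lies in the conjugate prime.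
  · exact ⟨P.comap τ, Ideal.comap_isPrime τ P, by simpa [Ideal.mem_comap] using hpP, hx⟩

theorem dvd_norm_geom_sum [CharZero R] (hN : ∀ x, (N x : R) = x * τ x) {p : ℕ} (hp : p.Prime) {β : R}
    (h : (p : ℤ) ∣ N (β - 1)) : (p : ℤ) ∣ N (∑ i ∈ Finset.range p, β ^ i) := by
  obtain ⟨P, hP, hpP, hβ⟩ := exists_isPrime_mem_of_dvd_norm hN hp h
  refine dvd_norm_of_mem hN hP hp hpP ?_
  rw [← Ideal.Quotient.eq_zero_iff_mem] at hβ hpP ⊢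
  rw [map_sub, map_one, sub_eq_zero] at hβ
  simpa [hβ] using hpP

theorem pow_succ_dvd_norm_pow_sub_one [CharZero R] (hN : ∀ x, (N x : R) = x * τ x) {p : ℕ} (hp : p.Prime) {β : R}
    (h : (p : ℤ) ∣ N (β - 1)) (i : ℕ) : (p : ℤ) ^ (i + 1) ∣ N (β ^ p ^ i - 1) := by
  induction i with
  | zero => simpa using h
  | succ i ih =>
    rw [pow_succ p i, pow_mul, ← mul_geom_sum, map_mul, pow_succ (p : ℤ)]
    exact mul_dvd_mul ih (dvd_norm_geom_sum hN hp ((dvd_pow_self _ i.succ_ne_zero).trans ih))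

/-- In `((1 + u)^p - 1) / u` the middle binomial coefficients are divisible by `p`. -/
theorem geom_sum_one_add_eq {p : ℕ} (hp : p.Prime) (hp2 : p ≠ 2) (u : R) :
    ∃ w, ∑ i ∈ Finset.range p, (1 + u) ^ i = p * (1 + u * w) + u ^ (p - 1) := by
  have h := congrArg (eval u) (geom_sum_X_comp_X_add_one_eq_sum (R := R) p)
  obtain ⟨q, rfl⟩ : ∃ q, p = q + 2 := ⟨p - 2, by have := hp.two_le; omega⟩
  simp only [eval_comp, eval_finsetSum, eval_pow, eval_X, eval_add, eval_one, eval_mul,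
    eval_natCast] at h
  rw [add_comm 1 u, h, Finset.sum_range_succ, Finset.sum_range_succ']
  have hk : ∀ k ∈ Finset.range q, ((q + 2 : ℕ) : R) * u ∣
      (((q + 2).choose (k + 1 + 1) : ℕ) : R) * u ^ (k + 1) := by
    intro k hk
    rw [Finset.mem_range] at hk
    exact mul_dvd_mul (Nat.cast_dvd_cast (hp.dvd_choose_self (by omega) (by omega)))
      (dvd_pow_self u k.succ_ne_zero)
  obtain ⟨w, hw⟩ := Finset.dvd_sum hk
  refine ⟨w, ?_⟩
  rw [hw]
  simp only [Nat.choose_self, Nat.choose_one_right, zero_add,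
    show q + 2 - 1 = q + 1 by omega]
  push_cast
  ring

/-- With `u = β - 1`, norm one gives `u^2 = -β * N u`. For odd `p` the hypotheses then make
`u^(p-1)` divisible by `p^2`, so the sum is `p * (1 + u*w + p*z)`, whose cofactor is 1 modulo any
prime containing `p` and `u`. -/
theorem not_pow_three_dvd_norm_geom_sum [CharZero R] [IsDomain R] (hN : ∀ x, (N x : R) = x * τ x) {p : ℕ} (hp : p.Prime)
    {β : R} (hβ : N β = 1) (h : (p : ℤ) ∣ N (β - 1))
    (h' : 5 ≤ p ∨ (p : ℤ) ^ 3 ∣ N (β - 1)) : ¬ (p : ℤ) ^ 3 ∣ N (∑ i ∈ Finset.range p, β ^ i) := by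
  have h1 : (1 : R) = β * τ β := by simpa [hβ] using hN β
  have hu : (β - 1) ^ 2 = - β * N (β - 1) := by
    rw [hN, map_sub, map_one]
    linear_combination (1 - β) * h1
  have hp0 : (p : R) ≠ 0 := Nat.cast_ne_zero.mpr hp.ne_zero
  by_cases hp2 : p = 2
  · subst hp2
    have h8 : (2 : ℤ) ^ 3 ∣ N (β - 1) := by
      rcases h' with h' | h'
      · omega
      · exact_mod_cast h'
    have h4 : N (∑ i ∈ Finset.range 2, β ^ i) = 4 - N (β - 1) := by
      have : ((N (∑ i ∈ Finset.range 2, β ^ i) : ℤ) : R) = ((4 - N (β - 1) : ℤ) : R) := by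
        rw [hN, Int.cast_sub, hN]
        simp only [Finset.sum_range_succ, Finset.sum_range_zero, map_add, map_sub, map_one,
          pow_zero, pow_one, zero_add, Int.cast_ofNat]
        linear_combination (-2) * h1
      exact_mod_cast this
    rw [h4]
    norm_num at h8 ⊢
    omega
  · obtain ⟨w, hw⟩ := geom_sum_one_add_eq hp hp2 (β - 1)
    rw [add_sub_cancel] at hw
    have hz : (p : R) ^ 2 ∣ (β - 1) ^ (p - 1) := by
      rcases h' with h5 | h3
      · obtain ⟨c, hc⟩ := h
        refine dvd_trans ⟨β ^ 2 * (c : R) ^ 2, ?_⟩ (pow_dvd_pow (β - 1) (show 4 ≤ p - 1 by omega))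
        rw [show (β - 1) ^ 4 = ((β - 1) ^ 2) ^ 2 by ring, hu, hc]
        push_cast
        ring
      · obtain ⟨c, hc⟩ := h3
        refine dvd_trans ⟨- β * p * c, ?_⟩
          (pow_dvd_pow (β - 1) (show 2 ≤ p - 1 by have := hp.two_le; omega))
        rw [hu, hc]
        push_cast
        ring
    obtain ⟨z, hz⟩ := hz
    rw [show ∑ i ∈ Finset.range p, β ^ i = p * (1 + (β - 1) * w + p * z) by
      rw [hw, hz]; ring, map_mul, map_natCast_of_eq_mul hN, pow_succ]
    intro hd
    have hd' := Int.dvd_of_mul_dvd_mul_left (by have := hp.pos; positivity) hd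
    obtain ⟨P, hP, hpP, hx⟩ := exists_isPrime_mem_of_dvd_norm hN hp hd'
    have hu' : β - 1 ∈ P := by
      apply hP.mem_of_pow_mem 2
      rw [hu]
      exact P.mul_mem_left _ ((intCast_mem_iff_dvd_of_natCast_mem hP hp hpP _).mpr h)
    apply hP.one_notMem
    have := P.sub_mem hx (P.add_mem (P.mul_mem_right w hu') (P.mul_mem_right z hpP))
    convert this using 1
    ring

theorem geom_sum_dvd_geom_sum_sq {p : ℕ} (hp : p.Prime) (hp2 : p ≠ 2) (β : R) :
    ∑ i ∈ Finset.range p, β ^ i ∣ ∑ i ∈ Finset.range p, (β ^ 2) ^ i := by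
  have := Fact.mk hp
  have hnd : ¬ 2 ∣ p := fun hd => hp2 ((Nat.prime_dvd_prime_iff_eq Nat.prime_two hp).mp hd).symm
  have h := congrArg (eval β) (cyclotomic_expand_eq_cyclotomic_mul Nat.prime_two hnd R)
  rw [expand_eval, eval_mul, cyclotomic_prime] at h
  simp only [eval_finsetSum, eval_pow, eval_X] at h
  exact ⟨_, h.trans (mul_comm _ _)⟩

theorem cyclotomic_dvd_geom_sum [IsDomain R] {n p : ℕ} (hn : n ≠ 0) (hp : p.Prime) (hpn : p ∣ n) (α : R) :
    (cyclotomic n R).eval α ∣ ∑ i ∈ Finset.range p, (α ^ (n / p)) ^ i := by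
  have hmem : n / p ∈ n.properDivisors :=
    Nat.mem_properDivisors.mpr ⟨Nat.div_dvd_of_dvd hpn, Nat.div_lt_self (by omega) hp.one_lt⟩
  have hd := X_pow_sub_one_mul_cyclotomic_dvd_X_pow_sub_one_of_dvd R hmem
  have hpos : 0 < n / p := Nat.div_pos (Nat.le_of_dvd (by omega) hpn) hp.pos
  have hfac : (X : R[X]) ^ n - 1 = (X ^ (n / p) - 1) * ∑ i ∈ Finset.range p, (X ^ (n / p)) ^ i := by
    rw [mul_geom_sum, ← pow_mul, Nat.div_mul_cancel hpn]
  rw [hfac] at hd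
  have := (mul_dvd_mul_iff_left (monic_X_pow_sub_C (1 : R) hpos.ne').ne_zero).mp
    (by simpa using hd)
  obtain ⟨q, hq⟩ := this
  refine ⟨q.eval α, ?_⟩
  have := congrArg (eval α) hq
  simpa only [eval_finsetSum, eval_pow, eval_X, eval_mul] using this

theorem exists_isPrimitiveRoot_of_dvd_norm_cyclotomic [CharZero R] (hN : ∀ x, (N x : R) = x * τ x) {p n : ℕ}
    (hp : p.Prime) (hn : n ≠ 0) {α : R} (h : (p : ℤ) ∣ N ((cyclotomic n R).eval α)) :
    ∃ P : Ideal R, P.IsPrime ∧ (p : R) ∈ P ∧ ∃ j r, n = p ^ j * r ∧ ¬ p ∣ r ∧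
      IsPrimitiveRoot (Ideal.Quotient.mk P α) r := by
  obtain ⟨P, hP, hpP, hx⟩ := exists_isPrime_mem_of_dvd_norm hN hp h
  obtain ⟨j, r, hr, hnr⟩ := Nat.exists_eq_pow_mul_and_not_dvd hn p hp.ne_one
  refine ⟨P, hP, hpP, j, r, hnr, hr, ?_⟩
  have := Fact.mk hp
  have := charP_quotient_of_natCast_mem hP hp hpP
  have : NeZero (r : R ⧸ P) := ⟨fun h0 => hr ((CharP.cast_eq_zero_iff (R ⧸ P) p r).mp h0)⟩
  rw [← isRoot_cyclotomic_prime_pow_mul_iff_of_charP (p := p) (k := j), ← hnr, IsRoot.def,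
    ← map_cyclotomic n (Ideal.Quotient.mk P), eval_map, eval₂_hom]
  exact Ideal.Quotient.eq_zero_iff_mem.mpr hx

/-- If `p` divides `N (α ^ m - 1)`, then the order of `α` modulo a prime above `p` divides `m`. -/
theorem order_dvd_of_dvd_norm_pow_sub_one (hN : ∀ x, (N x : R) = x * τ x) {p r m : ℕ}
    (hp : p.Prime) {α : R} {P : Ideal R} (hP : P.IsPrime) (hpP : (p : R) ∈ P)
    (hr : IsPrimitiveRoot (Ideal.Quotient.mk P α) r) (hm : (p : ℤ) ∣ N (α ^ m - 1))
    (hα : N α = 1 ∨ N α = -1 ∧ (p = 2 ∨ Odd r ∨ 4 ∣ r)) : r ∣ m := by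
  have hx := (intCast_mem_iff_dvd_of_natCast_mem hP hp hpP _).mpr hm
  rw [hN] at hx
  rcases hP.mem_or_mem hx with hx | hx
  · rw [← Ideal.Quotient.eq_zero_iff_mem] at hx
    apply hr.dvd_of_pow_eq_one
    simpa [sub_eq_zero] using hx
  have h1 := hN α
  -- If instead `τ(α)^m ≡ 1`, multiplying by `α^m` gives `α^m ≡ (N α)^m`.
  have hx' : Ideal.Quotient.mk P (α ^ m) = Ideal.Quotient.mk P ((N α : R) ^ m) := by
    rw [Ideal.Quotient.eq, h1]
    have := P.mul_mem_left (-α ^ m) hx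
    convert this using 1
    simp only [map_sub, map_pow, map_one]
    ring
  rcases hα with hα | ⟨hα, hcase⟩
  · apply hr.dvd_of_pow_eq_one
    simpa [hα] using hx'
  · rw [hα] at hx'
    rcases Nat.even_or_odd m with hme | hmo
    · apply hr.dvd_of_pow_eq_one
      simpa [hme.neg_one_pow] using hx'
    · have h2 : (Ideal.Quotient.mk P α) ^ m = -1 := by simpa [hmo.neg_one_pow] using hx'
      have h3 : r ∣ m * 2 := by
        apply hr.dvd_of_pow_eq_one
        rw [pow_mul, h2]
        norm_num
      rcases hcase with rfl | hro | h4
      · apply hr.dvd_of_pow_eq_one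
        have := charP_quotient_of_natCast_mem hP hp hpP
        rw [h2, CharTwo.neg_eq]
      · exact (Nat.Coprime.dvd_of_dvd_mul_right (Nat.coprime_two_right.mpr hro) h3)
      · exfalso
        obtain ⟨c, hc⟩ := h4.trans h3
        obtain ⟨d, hd⟩ := hmo
        omega

/-- `γ` satisfies `g^2 - t*g + 1 = 0` with integral trace `t`; each residue of `t` modulo 2 or 3
gives an order dividing 12. -/
theorem pow_eq_one_of_char_le_three (hN : ∀ x, (N x : R) = x * τ x) {p : ℕ} (hp : p.Prime)
    (hp3 : p ≤ 3) {γ : R} {P : Ideal R} (hpP : (p : R) ∈ P) (hγ : N γ = 1) :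
    (Ideal.Quotient.mk P γ) ^ 12 = 1 := by
  set g := Ideal.Quotient.mk P γ
  have h1 : γ * τ γ = 1 := by rw [← hN, hγ, Int.cast_one]
  obtain ⟨t, ht⟩ : ∃ t : ℤ, (t : R) = γ + τ γ := by
    refine ⟨N (1 + γ) - 2, ?_⟩
    rw [Int.cast_sub, hN, map_add, map_one]
    push_cast
    linear_combination h1
  have hq : g ^ 2 - t * g + 1 = 0 := by
    have : γ ^ 2 - t * γ + 1 = 0 := by rw [ht]; linear_combination -h1
    simpa using congrArg (Ideal.Quotient.mk P) this
  have hpz : (p : R ⧸ P) = 0 := by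
    rw [← Ideal.Quotient.eq_zero_iff_mem] at hpP
    simpa using hpP
  have hp23 : p = 2 ∨ p = 3 := by
    have := hp.two_le
    omega
  rcases hp23 with rfl | rfl
  · rcases Int.even_or_odd' t with ⟨k, rfl | rfl⟩
    · push_cast at hq hpz
      have : g ^ 2 = 1 := by linear_combination hq + (k * g - 1) * hpz
      rw [show g ^ 12 = (g ^ 2) ^ 6 by ring, this, one_pow]
    · push_cast at hq hpz
      have h2 : g ^ 2 = g - 1 := by linear_combination hq + (k * g) * hpz
      have h3 : g ^ 3 = -1 := by linear_combination (g + 1) * h2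
      rw [show g ^ 12 = (g ^ 3) ^ 4 by ring, h3]
      norm_num
  · push_cast at hpz
    have h3 : t = 3 * (t / 3) ∨ t = 3 * (t / 3) + 1 ∨ t = 3 * (t / 3) + 2 := by omega
    generalize t / 3 = k at h3
    rcases h3 with rfl | rfl | rfl
    · push_cast at hq
      have : g ^ 2 = -1 := by linear_combination hq + (k * g) * hpz
      rw [show g ^ 12 = (g ^ 2) ^ 6 by ring, this]
      norm_num
    · push_cast at hq
      have h2 : g ^ 2 = g - 1 := by linear_combination hq + (k * g) * hpz
      have h3 : g ^ 3 = -1 := by linear_combination (g + 1) * h2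
      rw [show g ^ 12 = (g ^ 3) ^ 4 by ring, h3]
      norm_num
    · push_cast at hq
      have h2 : g ^ 2 = - g - 1 := by linear_combination hq + (k * g + g) * hpz
      have h3 : g ^ 3 = 1 := by linear_combination (g - 1) * h2
      rw [show g ^ 12 = (g ^ 3) ^ 4 by ring, h3, one_pow]

/-- A prime dividing both `N (Φ_n(α))` and an earlier term `N (α ^ m - 1)` divides `n`, and its cube
does not divide `N (Φ_n(α))`. -/
theorem dvd_and_not_pow_three_dvd_norm_cyclotomic [CharZero R] [IsDomain R] (hN : ∀ x, (N x : R) = x * τ x) {p n m : ℕ}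
    (hp : p.Prime) (hn : 216 < n) {α : R} (hα : N α = 1 ∨ N α = -1 ∧ ¬ n ≡ 2 [MOD 4])
    (h : (p : ℤ) ∣ N ((cyclotomic n R).eval α)) (hm : 1 ≤ m) (hmn : m < n)
    (hpm : (p : ℤ) ∣ N (α ^ m - 1)) :
    p ∣ n ∧ ¬ (p : ℤ) ^ 3 ∣ N ((cyclotomic n R).eval α) := by
  obtain ⟨P, hP, hpP, j, r, hnr, hpr, hroot⟩ :=
    exists_isPrimitiveRoot_of_dvd_norm_cyclotomic hN hp (by omega) h
  have hodd : N α = -1 → ¬ n ≡ 2 [MOD 4] → p = 2 ∨ Odd r ∨ 4 ∣ r := by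
    intro _ hn4
    by_cases hp2 : p = 2
    · exact Or.inl hp2
    right
    have hpj : Odd (p ^ j) := (hp.odd_of_ne_two hp2).pow
    rcases Nat.even_or_odd r with hre | hro
    · right
      have hev : 2 ∣ n := hnr ▸ Dvd.dvd.mul_left hre.two_dvd _
      have h4 : 4 ∣ n := by
        unfold Nat.ModEq at hn4
        omega
      rw [hnr] at h4
      exact Nat.Coprime.dvd_of_dvd_mul_left
        (Nat.Coprime.pow_left 2 (Nat.coprime_two_left.mpr hpj) : Nat.Coprime (2 ^ 2) (p ^ j)) h4
    · exact Or.inl hro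
  have hrm : r ∣ m := order_dvd_of_dvd_norm_pow_sub_one hN hp hP hpP hroot hpm
    (hα.imp_right fun hα => ⟨hα.1, hodd hα.1 hα.2⟩)
  obtain ⟨i, rfl⟩ : ∃ i, j = i + 1 := by
    refine Nat.exists_eq_succ_of_ne_zero ?_
    rintro rfl
    rw [pow_zero, one_mul] at hnr
    subst hnr
    exact absurd (Nat.le_of_dvd hm hrm) (by omega)
  have hpn : p ∣ n := hnr ▸ Dvd.dvd.mul_right (dvd_pow_self p i.succ_ne_zero) r
  have hdiv : n / p = r * p ^ i := by
    rw [hnr, pow_succ]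
    exact Nat.div_eq_of_eq_mul_left hp.pos (by ring)
  refine ⟨hpn, fun hcube => ?_⟩
  set β := α ^ (n / p) with hβ
  have hcube' : (p : ℤ) ^ 3 ∣ N (∑ k ∈ Finset.range p, β ^ k) :=
    hcube.trans (map_dvd N (cyclotomic_dvd_geom_sum (by omega) hp hpn α))
  have hr1 : (p : ℤ) ∣ N (α ^ r - 1) := by
    refine dvd_norm_of_mem hN hP hp hpP ?_
    rw [← Ideal.Quotient.eq_zero_iff_mem]
    simp [hroot.pow_eq_one]
  have hpow : (p : ℤ) ^ (i + 1) ∣ N (β - 1) := by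
    rw [hβ, hdiv, pow_mul]
    exact pow_succ_dvd_norm_pow_sub_one hN hp hr1 i
  have hβ1 : (p : ℤ) ∣ N (β - 1) := (dvd_pow_self _ i.succ_ne_zero).trans hpow
  have hβ3 : 5 ≤ p ∨ (p : ℤ) ^ 3 ∣ N (β - 1) := by
    by_cases hp5 : 5 ≤ p
    · exact Or.inl hp5
    right
    have hp3 : p ≤ 3 := by
      have : p ≠ 4 := by rintro rfl; exact absurd hp (by norm_num)
      omega
    have hr24 : r ∣ 24 := by
      apply hroot.dvd_of_pow_eq_one
      have h2 : N (α ^ 2) = 1 := by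
        rcases hα with hα | hα
        · simp [hα]
        · simp [hα.1]
      have := pow_eq_one_of_char_le_three hN hp hp3 hpP h2
      rw [map_pow, ← pow_mul] at this
      exact this
    have hr : r ≤ 24 := Nat.le_of_dvd (by norm_num) hr24
    -- This is where `216 = 3^2 * 24` comes from.
    have hi : 2 ≤ i := by
      by_contra! hi
      have : p ^ (i + 1) ≤ 3 ^ 2 :=
        (Nat.pow_le_pow_left hp3 _).trans (Nat.pow_le_pow_right (by norm_num) (by omega))
      have := Nat.mul_le_mul this hr
      omega
    exact (pow_dvd_pow _ (by omega)).trans hpow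
  have hNβ : N β = 1 ∨ N β = -1 ∧ p ≠ 2 := by
    rcases hα with hα | ⟨hα, hn4⟩
    · left; rw [hβ, map_pow, hα, one_pow]
    · rw [hβ, map_pow, hα]
      rcases Nat.even_or_odd (n / p) with he | ho
      · exact Or.inl he.neg_one_pow
      · refine Or.inr ⟨ho.neg_one_pow, ?_⟩
        rintro rfl
        obtain ⟨d, hd⟩ := ho
        unfold Nat.ModEq at hn4
        omega
  -- When `N β = -1`, `p` is odd and `β^2` has norm one, with `Φ_p(β) ∣ Φ_p(β^2)`.
  rcases hNβ with hNβ | ⟨hNβ, hp2⟩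
  · exact not_pow_three_dvd_norm_geom_sum hN hp hNβ hβ1 hβ3 hcube'
  · have hd : N (β - 1) ∣ N (β ^ 2 - 1) := map_dvd N (sub_one_dvd_pow_sub_one _ _)
    exact not_pow_three_dvd_norm_geom_sum hN hp (by rw [map_pow, hNβ]; norm_num) (hβ1.trans hd)
      (hβ3.imp_right fun h => h.trans hd)
      (hcube'.trans (map_dvd N (geom_sum_dvd_geom_sum_sq hp hp2 β)))

end QuadraticNorm

/-! ### Growth of the totient. -/

/-- The odd case is carried along because at most one of two coprime factors is even, so the factor
2 is lost only once. -/
theorem le_two_mul_totient_sq (n : ℕ) : n ≤ 2 * n.totient ^ 2 ∧ (Odd n → n ≤ n.totient ^ 2) := by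
  induction n using Nat.recOnPosPrimePosCoprime with
  | zero => simp
  | one => simp
  | prime_pow p n hp hn =>
    rw [Nat.totient_prime_pow hp hn]
    obtain ⟨k, rfl⟩ : ∃ k, n = k + 1 := ⟨n - 1, by omega⟩
    obtain ⟨q, rfl⟩ : ∃ q, p = q + 2 := ⟨p - 2, by have := hp.two_le; omega⟩
    have hk : 1 ≤ (q + 2) ^ k := Nat.one_le_pow _ _ (by omega)
    simp only [Nat.add_sub_cancel, show q + 2 - 1 = q + 1 by omega, pow_succ]
    generalize (q + 2) ^ k = x at hk
    have hx : x ≤ x * x := Nat.le_mul_of_pos_left x hk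
    have key : ∀ c, q + 2 ≤ c * ((q + 1) * (q + 1)) →
        x * (q + 2) ≤ c * (x * (q + 1) * (x * (q + 1))) := fun c hc =>
      (Nat.mul_le_mul hx hc).trans_eq (by ring)
    constructor
    · simpa using key 2 (by nlinarith)
    · intro ho
      have hq : q ≠ 0 := by
        rintro rfl
        rw [Nat.odd_mul] at ho
        exact absurd ho.2 (by decide)
      simpa using key 1 (by nlinarith [Nat.pos_of_ne_zero hq])
  | coprime a b ha hb hab iha ihb =>
    rw [Nat.totient_mul hab, mul_pow]
    refine ⟨?_, fun ho => ?_⟩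
    · rcases Nat.even_or_odd a with hae | hao
      · have hbo : Odd b := by
          rw [← Nat.not_even_iff_odd]
          intro hbe
          have := Nat.dvd_gcd hae.two_dvd hbe.two_dvd
          rw [hab] at this
          omega
        exact (Nat.mul_le_mul iha.1 (ihb.2 hbo)).trans_eq (by ring)
      · exact (Nat.mul_le_mul (iha.2 hao) ihb.1).trans_eq (by ring)
    · rw [Nat.odd_mul] at ho
      exact Nat.mul_le_mul (iha.2 ho.1) (ihb.2 ho.2)

theorem pow_four_lt_two_pow_totient {n : ℕ} (hn : 8192 < n) : n ^ 4 < 2 ^ n.totient := by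
  have h := (le_two_mul_totient_sq n).1
  -- `8192 = 2 * 64^2`.
  have hφ : 64 ≤ n.totient := by
    by_contra! hlt
    nlinarith
  have key : ∀ k, 64 ≤ k → 16 * k ^ 8 < 2 ^ k := by
    intro k hk
    induction k, hk using Nat.le_induction with
    | base => norm_num
    | succ k hk ih =>
      have h1 : (64 * (k + 1)) ^ 8 ≤ (65 * k) ^ 8 := Nat.pow_le_pow_left (by omega) 8
      rw [mul_pow, mul_pow] at h1
      rw [pow_succ 2 k]
      omega
  calc n ^ 4 ≤ (2 * n.totient ^ 2) ^ 4 := Nat.pow_le_pow_left h 4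
    _ = 16 * n.totient ^ 8 := by ring
    _ < _ := key _ hφ

/-! ### Lower bound for `|N(Φ_n(α))|`. -/

/-- The product is `|Φ_n(d)|`, a nonzero integer since `d = ±1` has order below 3. -/
theorem one_le_prod_primitiveRoots_norm_sub {n : ℕ} (hn : 3 ≤ n) {d : ℤ} (hd : d ^ 2 = 1) :
    1 ≤ ∏ ζ ∈ primitiveRoots n ℂ, ‖(d : ℂ) - ζ‖ := by
  have hprod : ∏ ζ ∈ primitiveRoots n ℂ, ((d : ℂ) - ζ) = (((cyclotomic n ℤ).eval d : ℤ) : ℂ) := by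
    have h := congrArg (eval (d : ℂ)) (cyclotomic_eq_prod_X_sub_primitiveRoots
      (Complex.isPrimitiveRoot_exp n (by omega)))
    rw [← map_cyclotomic_int, eval_intCast_map, eval_prod] at h
    simpa using h.symm
  rw [← norm_prod, hprod, Complex.norm_intCast]
  have hne : (cyclotomic n ℤ).eval d ≠ 0 := by
    intro h0
    have : NeZero (n : ℤ) := ⟨by positivity⟩
    have hr : IsPrimitiveRoot d n := isRoot_cyclotomic_iff.mp h0
    have := Nat.le_of_dvd two_pos (hr.dvd_of_pow_eq_one 2 hd)
    omega
  exact_mod_cast Int.one_le_abs hne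

/-- On the unit circle the right side is `|s - 2 Re z| ≥ 3 - 2d Re z = 1 + |d - z|^2`; conclude by
AM-GM. -/
theorem two_mul_norm_sub_le {z : ℂ} (hz : ‖z‖ = 1) {s d : ℤ} (hd : d ^ 2 = 1) (hs : 3 ≤ d * s) :
    2 * ‖(d : ℂ) - z‖ ≤ ‖z ^ 2 - s * z + 1‖ := by
  have hz' : z.re ^ 2 + z.im ^ 2 = 1 := by
    have := Complex.sq_norm z
    rw [hz, Complex.normSq_apply] at this
    linarith
  have hdR : (d : ℝ) ^ 2 = 1 := by exact_mod_cast hd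
  have hsR : (3 : ℝ) ≤ d * s := by exact_mod_cast hs
  have h1 : ‖(d : ℂ) - z‖ ^ 2 = 2 - 2 * d * z.re := by
    rw [Complex.sq_norm, Complex.normSq_apply]
    simp
    linear_combination hdR + hz'
  have h2 : ‖z ^ 2 - s * z + 1‖ ^ 2 = (d * s - 2 * d * z.re) ^ 2 := by
    rw [Complex.sq_norm, Complex.normSq_apply]
    simp [pow_two]
    linear_combination (z.re ^ 2 + z.im ^ 2 + s ^ 2 - 2 * s * z.re - 1) * hz' - (s - 2 * z.re) ^ 2 * hdR
  have h3 : 1 + ‖(d : ℂ) - z‖ ^ 2 ≤ ‖z ^ 2 - s * z + 1‖ := by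
    rw [h1]
    linarith [le_of_abs_le (abs_le_of_sq_le_sq h2.ge (norm_nonneg _))]
  nlinarith [sq_nonneg (‖(d : ℂ) - z‖ - 1)]

/-- On the unit circle the right side is `s^2 + 4 (Im z)^2 ≥ 1 + |1 - z^2|^2`. -/
theorem two_mul_norm_sub_mul_norm_sub_le {z : ℂ} (hz : ‖z‖ = 1) {s : ℤ} (hs : s ≠ 0) :
    2 * (‖((1 : ℤ) : ℂ) - z‖ * ‖((-1 : ℤ) : ℂ) - z‖) ≤ ‖z ^ 2 - s * z - 1‖ ^ 2 := by
  have hz' : z.re ^ 2 + z.im ^ 2 = 1 := by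
    have := Complex.sq_norm z
    rw [hz, Complex.normSq_apply] at this
    linarith
  have hsR : (1 : ℝ) ≤ (s : ℝ) ^ 2 := by
    exact_mod_cast Int.one_le_abs (pow_ne_zero 2 hs) |>.trans_eq (abs_of_nonneg (sq_nonneg s))
  rw [← norm_mul]
  have h1 : ‖(((1 : ℤ) : ℂ) - z) * (((-1 : ℤ) : ℂ) - z)‖ ^ 2 = 4 * z.im ^ 2 := by
    rw [Complex.sq_norm, Complex.normSq_apply]
    simp
    linear_combination (z.re ^ 2 + z.im ^ 2 - 1) * hz'
  have h2 : ‖z ^ 2 - s * z - 1‖ ^ 2 = s ^ 2 + 4 * z.im ^ 2 := by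
    rw [Complex.sq_norm, Complex.normSq_apply]
    simp [pow_two]
    linear_combination (z.re ^ 2 + z.im ^ 2 + s ^ 2 - 2 * s * z.re - 1) * hz'
  rw [h2]
  nlinarith [sq_nonneg (‖(((1 : ℤ) : ℂ) - z) * (((-1 : ℤ) : ℂ) - z)‖ - 1)]

theorem two_pow_totient_le_prod_norm_sq {n : ℕ} (hn : 3 ≤ n) {s e : ℤ}
    (h : e = 1 ∧ 3 ≤ |s| ∨ e = -1 ∧ s ≠ 0) :
    2 ^ n.totient ≤ (∏ ζ ∈ primitiveRoots n ℂ, ‖ζ ^ 2 - s * ζ + e‖) ^ 2 := by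
  have hnorm : ∀ ζ ∈ primitiveRoots n ℂ, ‖ζ‖ = 1 := fun ζ hζ =>
    (isPrimitiveRoot_of_mem_primitiveRoots hζ).norm'_eq_one (by omega)
  have hcard : (primitiveRoots n ℂ).card = n.totient :=
    (Complex.isPrimitiveRoot_exp n (by omega)).card_primitiveRoots
  rcases h with ⟨rfl, hs⟩ | ⟨rfl, hs⟩
  · obtain ⟨d, hd, hds⟩ : ∃ d : ℤ, d ^ 2 = 1 ∧ 3 ≤ d * s := by
      rcases abs_cases s with ⟨h, _⟩ | ⟨h, _⟩
      · exact ⟨1, by norm_num, by omega⟩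
      · exact ⟨-1, by norm_num, by omega⟩
    have h1 : (2 : ℝ) ^ n.totient ≤ ∏ ζ ∈ primitiveRoots n ℂ, ‖ζ ^ 2 - s * ζ + ((1 : ℤ) : ℂ)‖ :=
      calc (2 : ℝ) ^ n.totient
          ≤ 2 ^ n.totient * ∏ ζ ∈ primitiveRoots n ℂ, ‖(d : ℂ) - ζ‖ :=
            le_mul_of_one_le_right (by positivity) (one_le_prod_primitiveRoots_norm_sub hn hd)
        _ = ∏ ζ ∈ primitiveRoots n ℂ, 2 * ‖(d : ℂ) - ζ‖ := by
            rw [Finset.prod_mul_distrib, Finset.prod_const, hcard]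
        _ ≤ _ := Finset.prod_le_prod (fun _ _ => by positivity) fun ζ hζ => by
            simpa using two_mul_norm_sub_le (hnorm ζ hζ) hd hds
    nlinarith [one_le_pow₀ (n := n.totient) (one_le_two (α := ℝ))]
  · rw [← Finset.prod_pow]
    calc (2 : ℝ) ^ n.totient
        ≤ 2 ^ n.totient * ((∏ ζ ∈ primitiveRoots n ℂ, ‖((1 : ℤ) : ℂ) - ζ‖) *
            ∏ ζ ∈ primitiveRoots n ℂ, ‖((-1 : ℤ) : ℂ) - ζ‖) :=
          le_mul_of_one_le_right (by positivity) (one_le_mul_of_one_le_of_one_le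
            (one_le_prod_primitiveRoots_norm_sub hn (by norm_num))
            (one_le_prod_primitiveRoots_norm_sub hn (by norm_num)))
      _ = ∏ ζ ∈ primitiveRoots n ℂ, 2 * (‖((1 : ℤ) : ℂ) - ζ‖ * ‖((-1 : ℤ) : ℂ) - ζ‖) := by
          rw [Finset.prod_mul_distrib, Finset.prod_const, hcard, Finset.prod_mul_distrib]
      _ ≤ _ := Finset.prod_le_prod (fun _ _ => by positivity) fun ζ hζ => by
          simpa [sub_eq_add_neg] using two_mul_norm_sub_mul_norm_sub_le (hnorm ζ hζ) hs

section QuadraticNorm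

variable {R : Type*} [CommRing R] {τ : R →+* R} {N : R →* ℤ}

theorem abs_norm_cyclotomic_eq_prod (hN : ∀ x, (N x : R) = x * τ x) (ψ : R →+* ℂ) {n : ℕ}
    (hn : n ≠ 0) {α : R} {s : ℤ} (hs : (s : R) = α + τ α) :
    |(N ((cyclotomic n R).eval α) : ℝ)| =
      ∏ ζ ∈ primitiveRoots n ℂ, ‖ζ ^ 2 - s * ζ + N α‖ := by
  have heval : ∀ x, ψ ((cyclotomic n R).eval x) = ∏ ζ ∈ primitiveRoots n ℂ, (ψ x - ζ) := by
    intro x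
    have h := congrArg (eval (ψ x)) (cyclotomic_eq_prod_X_sub_primitiveRoots
      (Complex.isPrimitiveRoot_exp n hn))
    rw [← map_cyclotomic n ψ, eval_map, eval₂_hom, eval_prod] at h
    simpa using h
  have hτ : τ ((cyclotomic n R).eval α) = (cyclotomic n R).eval (τ α) := by
    rw [← eval₂_hom, ← eval_map, map_cyclotomic]
  have h := congrArg ψ (hN ((cyclotomic n R).eval α))
  have hs' : (s : ℂ) = ψ α + ψ (τ α) := by rw [← map_add, ← hs, map_intCast]
  have he' : (N α : ℂ) = ψ α * ψ (τ α) := by rw [← map_mul, ← hN, map_intCast]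
  rw [map_intCast, map_mul, hτ, heval, heval, ← Finset.prod_mul_distrib] at h
  rw [← norm_prod, ← Complex.norm_intCast, h]
  congr 1
  refine Finset.prod_congr rfl fun ζ _ => ?_
  rw [hs', he']
  ring

theorem two_pow_totient_le_norm_cyclotomic_sq (hN : ∀ x, (N x : R) = x * τ x) {φ : R →+* ℝ}
    (hφ : Function.Injective φ) {n : ℕ} (hn : 3 ≤ n) {α : R} (h1 : α ≠ 1) (h2 : α ≠ -1)
    (hα : N α = 1 ∨ N α = -1) : 2 ^ n.totient ≤ N ((cyclotomic n R).eval α) ^ 2 := by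
  have hmul := hN α
  obtain ⟨s, hs⟩ : ∃ s : ℤ, (s : R) = α + τ α := by
    refine ⟨N (1 + α) - 1 - N α, ?_⟩
    rw [Int.cast_sub, Int.cast_sub, hN, hN, map_add, map_one]
    push_cast
    ring
  have hsq : α ^ 2 ≠ 1 := fun h => by
    have h' : φ α ^ 2 = 1 := by rw [← map_pow, h, map_one]
    rcases mul_self_eq_one_iff.mp ((sq _).symm.trans h') with h' | h'
    · exact h1 (hφ (by rw [h', map_one]))
    · exact h2 (hφ (by rw [h', map_neg, map_one]))
  have hs' : (s : ℝ) = φ α + φ (τ α) := by rw [← map_add, ← hs, map_intCast]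
  have he' : (N α : ℝ) = φ α * φ (τ α) := by rw [← map_mul, ← hN, map_intCast]
  have hcases : N α = 1 ∧ 3 ≤ |s| ∨ N α = -1 ∧ s ≠ 0 := by
    refine hα.imp (fun hα => ⟨hα, ?_⟩) fun hα => ⟨hα, ?_⟩
    · rw [hα] at he' hmul
      have hne : φ α - φ (τ α) ≠ 0 := by
        rw [sub_ne_zero]
        intro h
        have := hφ h
        rw [← this, ← sq] at hmul
        exact hsq (by simpa using hmul.symm)
      -- `s^2 - 4` is the square of the nonzero real number `φ α - φ (τ α)`.
      have hdisc : (2 : ℝ) ^ 2 < (s : ℝ) ^ 2 := by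
        push_cast at he'
        have := pow_pos (abs_pos.mpr hne) 2
        rw [sq_abs] at this
        rw [hs']
        linarith
      have hdisc' : (2 : ℤ) ^ 2 < s ^ 2 := by exact_mod_cast hdisc
      have := sq_lt_sq.mp hdisc'
      norm_num at this
      omega
    · rintro rfl
      rw [hα] at hmul
      push_cast at hs hmul
      exact hsq (by linear_combination hmul - α * hs)
  have h := two_pow_totient_le_prod_norm_sq hn hcases
  rw [← abs_norm_cyclotomic_eq_prod hN (Complex.ofRealHom.comp φ) (by omega) hs, sq_abs] at h
  exact_mod_cast h

/-! ### Comparison of the two estimates. -/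

theorem hasPrimitivePrimeDivisor_norm_pow_sub_one [CharZero R] [IsDomain R]
    (hN : ∀ x, (N x : R) = x * τ x) {φ : R →+* ℝ} (hφ : Function.Injective φ) {n : ℕ}
    (hn : 8192 < n) {α : R} (h1 : α ≠ 1) (h2 : α ≠ -1)
    (hα : N α = 1 ∨ N α = -1 ∧ ¬ n ≡ 2 [MOD 4]) :
    HasPrimitivePrimeDivisor (fun k => N (α ^ k - 1)) n := by
  by_contra hprim
  set F := N ((cyclotomic n R).eval α) with hF
  have hlow : (2 : ℤ) ^ n.totient ≤ F ^ 2 :=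
    two_pow_totient_le_norm_cyclotomic_sq hN hφ (by omega) h1 h2 (hα.imp_right And.left)
  have hF0 : F ≠ 0 := by
    intro h0
    rw [h0] at hlow
    have : (0 : ℤ) < 2 ^ n.totient := by positivity
    omega
  have hdvd : F ∣ N (α ^ n - 1) := by
    refine map_dvd N ?_
    obtain ⟨q, hq⟩ := cyclotomic.dvd_X_pow_sub_one n R
    exact ⟨q.eval α, by simpa using congrArg (eval α) hq⟩
  have hle : F.natAbs ∣ n ^ 2 := by
    rw [← Nat.factorization_le_iff_dvd (Int.natAbs_ne_zero.mpr hF0) (by positivity),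
      Finsupp.le_iff]
    intro p hp
    have hpp := Nat.prime_of_mem_primeFactors hp
    have hpF : (p : ℤ) ∣ F := Int.natCast_dvd.mpr (Nat.dvd_of_mem_primeFactors hp)
    have hex : ∃ m, 1 ≤ m ∧ m < n ∧ (p : ℤ) ∣ N (α ^ m - 1) := by
      by_contra! hno
      exact hprim ⟨p, hpp, hpF.trans hdvd, fun m h1 h2 _ => hno m h1 h2⟩
    obtain ⟨m, hm1, hmn, hpm⟩ := hex
    obtain ⟨hpn, hcube⟩ := dvd_and_not_pow_three_dvd_norm_cyclotomic hN hpp (by omega) hα hpF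
      hm1 hmn hpm
    have hlt : F.natAbs.factorization p < 3 := by
      by_contra! hge
      apply hcube
      have := (hpp.pow_dvd_iff_le_factorization (Int.natAbs_ne_zero.mpr hF0)).mpr hge
      exact_mod_cast Int.natCast_dvd.mpr this
    have hpos := hpp.factorization_pos_of_dvd (by omega : n ≠ 0) hpn
    rw [Nat.factorization_pow, Finsupp.smul_apply, smul_eq_mul]
    omega
  have hle' : (F.natAbs : ℤ) ≤ n ^ 2 := by exact_mod_cast Nat.le_of_dvd (by positivity) hle
  have hup : F ^ 2 ≤ (n : ℤ) ^ 4 := by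
    rw [← Int.natAbs_sq F, show (n : ℤ) ^ 4 = (n ^ 2) ^ 2 by ring]
    exact pow_le_pow_left₀ (by positivity) hle' 2
  have hbig : (n : ℤ) ^ 4 < 2 ^ n.totient := by exact_mod_cast pow_four_lt_two_pow_totient hn
  omega

end QuadraticNorm

/-! ### Specialisation to real quadratic fields, with `τ` the Galois conjugation. -/

section RealQuadraticField

variable {K : Type*} [Field K] [NumberField K]

theorem exists_ringHom_norm_eq_mul (hK : Module.finrank ℚ K = 2) :
    ∃ τ : 𝓞 K →+* 𝓞 K, ∀ x : 𝓞 K, ((Algebra.norm ℤ x : ℤ) : 𝓞 K) = x * τ x := by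
  classical
  have : Algebra.IsQuadraticExtension ℚ K := ⟨hK⟩
  have hcard : Fintype.card Gal(K/ℚ) = 2 := by
    rw [← Nat.card_eq_fintype_card, IsGalois.card_aut_eq_finrank, hK]
  obtain ⟨σ, hσ⟩ := Fintype.exists_ne_of_one_lt_card (by omega) (1 : Gal(K/ℚ))
  refine ⟨NumberField.RingOfIntegers.mapRingHom (σ : K →+* K), fun x => ?_⟩
  have huniv : (Finset.univ : Finset Gal(K/ℚ)) = {1, σ} := by
    symm
    rw [← Finset.card_eq_iff_eq_univ, Finset.card_pair hσ.symm, hcard]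
  have h := Algebra.norm_eq_prod_automorphisms ℚ (x : K)
  rw [huniv, Finset.prod_pair hσ.symm, ← Algebra.coe_norm_int] at h
  apply NumberField.RingOfIntegers.ext
  simpa using h

theorem hasPrimitivePrimeDivisor_lehmerPierce (hK : IsRealQuadraticField K) {α : (𝓞 K)ˣ}
    (h1 : α ≠ 1) (h2 : α ≠ -1) {n : ℕ} (hn : 8192 < n)
    (hα : Algebra.norm ℚ ((α : 𝓞 K) : K) = 1 ∨
      Algebra.norm ℚ ((α : 𝓞 K) : K) = -1 ∧ ¬ n ≡ 2 [MOD 4]) :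
    HasPrimitivePrimeDivisor (lehmerPierce (α : 𝓞 K)) n := by
  obtain ⟨hfin, ⟨f⟩⟩ := hK
  obtain ⟨τ, hτ⟩ := exists_ringHom_norm_eq_mul hfin
  rw [← Algebra.coe_norm_int] at hα
  exact hasPrimitivePrimeDivisor_norm_pow_sub_one (N := Algebra.norm ℤ) hτ
    (φ := f.comp (algebraMap (𝓞 K) K))
    (f.injective.comp NumberField.RingOfIntegers.coe_injective) hn
    (fun h => h1 (Units.ext h)) (fun h => h2 (Units.ext h)) (by exact_mod_cast hα)

end RealQuadraticField

theorem zsigmondyBound_le {a : ℕ → ℤ} {C : ℕ} (h : ∀ n, C < n → HasPrimitivePrimeDivisor a n) :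
    zsigmondyBound a ≤ C := by
  have hle : ∀ n ∈ nonPrimitiveIndices a, n ≤ C := fun n hn => by
    by_contra! hlt
    exact hn.2 (h n hlt)
  have hfin : (nonPrimitiveIndices a).Finite := (Set.finite_Iic C).subset hle
  rw [zsigmondyBound, dif_pos hfin]
  exact_mod_cast Finset.sup_le fun n hn => hle n (hfin.mem_toFinset.mp hn)

theorem corollary1p3 :
    (∃ C₁ : ℕ, 0 < C₁ ∧
      ∀ (K : Type*) [Field K] [NumberField K], IsRealQuadraticField K →
        ∀ α : (𝓞 K)ˣ, α ≠ 1 → α ≠ -1 → Algebra.norm ℚ ((α : 𝓞 K) : K) = 1 →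
          zsigmondyBound (lehmerPierce (α : 𝓞 K)) ≤ (C₁ : ℕ∞)) ∧
    (∃ C₂ : ℕ, 0 < C₂ ∧
      ∀ (K : Type*) [Field K] [NumberField K], IsRealQuadraticField K →
        ∀ α : (𝓞 K)ˣ, α ≠ 1 → α ≠ -1 → Algebra.norm ℚ ((α : 𝓞 K) : K) = -1 →
          ∀ n : ℕ, C₂ < n → ¬ n ≡ 2 [MOD 4] →
            HasPrimitivePrimeDivisor (lehmerPierce (α : 𝓞 K)) n) :=
  ⟨⟨8192, by norm_num, fun _ _ _ hK _ h1 h2 hα => zsigmondyBound_le fun _ hn =>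
      hasPrimitivePrimeDivisor_lehmerPierce hK h1 h2 hn (Or.inl hα)⟩,
    ⟨8192, by norm_num, fun _ _ _ hK _ h1 h2 hα _ hn h4 =>
      hasPrimitivePrimeDivisor_lehmerPierce hK h1 h2 hn (Or.inr ⟨hα, h4⟩)⟩⟩
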